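/- Call a continuous function $f\colon\mathbb{R}\to\mathbb{C}$ almost periodic in the sense of Bohr if, for every $\varepsilon>0$, the set $\{t\in\mathbb{R} : \sup_{x\in\mathbb{R}}|f(x)-f(x-t)|<\varepsilon\}$ is relatively dense in $\mathbb{R}$, that is, there is $L>0$ such that every interval $[a,a+L]$ with $a\in\mathbb{R}$ contains an element of it. Let $\alpha\in\mathbb{R}$ with $|\alpha|>1$, and let $f\colon\mathbb{R}\to\mathbb{C}$ be almost periodic in the sense of Bohr. Then the mean \[ M(f)=\lim_{T\to\infty}\frac{1}{2T}\int_{a-T}^{a+T} f(x)\,\mathrm{d}x \] exists for every $a\in\mathbb{R}$, is independent of $a$, with convergence uniform in $a$, and for Lebesgue-almost every $x\in\mathbb{R}$ one has \[ \lim_{N\to\infty}\frac1N\sum_{n=0}^{N-1} f(\alpha^n x)=M(f). \] -/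

import Mathlib

open Filter Topology MeasureTheory

/-- A set `S` of reals is relatively dense: every interval of some fixed length meets it. -/
def IsRelativelyDense (S : Set ℝ) : Prop :=
  ∃ L : ℝ, 0 < L ∧ ∀ a : ℝ, ∃ t ∈ S, t ∈ Set.Icc a (a + L)

/-- The `ε`-almost periods of `f`: all `t` with `‖f - T_t f‖_∞ < ε`, where `(T_t f)(x) = f(x - t)`.
The supremum is taken in `[0, ∞]`. -/
def almostPeriods (f : ℝ → ℂ) (ε : ℝ) : Set ℝ :=
  {t : ℝ | (⨆ x : ℝ, ‖f x - f (x - t)‖ₑ) < ENNReal.ofReal ε}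

/-- Almost periodicity in the sense of Bohr. -/
def IsBohrAlmostPeriodic (f : ℝ → ℂ) : Prop :=
  Continuous f ∧ ∀ ε : ℝ, 0 < ε → IsRelativelyDense (almostPeriods f ε)

/-- `M` is the mean of `f`: `(1 / 2T) ∫_{a-T}^{a+T} f` tends to `M` as `T → ∞`,
uniformly in `a : ℝ`. -/
def HasMean (f : ℝ → ℂ) (M : ℂ) : Prop :=
  TendstoUniformly (fun T a : ℝ => (1 / (2 * T)) • ∫ x in (a - T)..(a + T), f x)
    (fun _ => M) atTop

/-! Almost periodicity enters only through boundedness, uniform continuity and the uniform existence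
of the mean `M`. Subtract `M` and pass to real and imaginary parts: what remains is a bounded,
uniformly continuous real function with uniformly small averages over long intervals. Smoothing it
at a short scale and then subtracting its average at a long scale changes it uniformly little, and
produces `g` with bounded primitive and bounded derivative (`exists_approx_bounded_primitive`). For
such `g`, integration by parts bounds the correlation of g(α^n x) and g(α^m x), m ≤ n, on a bounded
interval by a constant times |α|^(m-n) (`abs_integral_mul_comp_mul_le`). Hence the N-th partial sum
has mean square O(N), and summability along N = k² gives almost everywhere convergence
(`ae_tendsto_average_zero_of_integral_sq_le`). No Fourier expansion is needed. -/

/-- The average of `φ` over the interval `[x, x + s]`. -/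
noncomputable def forwardAverage {E : Type*} [NormedAddCommGroup E] [NormedSpace ℝ E]
    (φ : ℝ → E) (s x : ℝ) : E :=
  s⁻¹ • ∫ u in x..x + s, φ u

/-! ### Averages over intervals -/

section ForwardAverage

variable {E : Type*} [NormedAddCommGroup E] [NormedSpace ℝ E]

theorem norm_forwardAverage_sub_le [CompleteSpace E] {φ : ℝ → E} (hφ : Continuous φ)
    {s x C : ℝ} (hs : 0 < s) {c : E}
    (h : ∀ u ∈ Set.Icc x (x + s), ‖φ u - c‖ ≤ C) : ‖forwardAverage φ s x - c‖ ≤ C := by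
  have h1 : forwardAverage φ s x - c = s⁻¹ • ∫ u in x..x + s, (φ u - c) := by
    rw [intervalIntegral.integral_sub (hφ.intervalIntegrable _ _) (by simp)]
    simp [forwardAverage, smul_sub, smul_smul, hs.ne']
  have h2 : ‖∫ u in x..x + s, (φ u - c)‖ ≤ C * |x + s - x| := by
    apply intervalIntegral.norm_integral_le_of_norm_le_const
    intro u hu
    rw [Set.uIoc_of_le (by linarith)] at hu
    exact h u ⟨hu.1.le, hu.2⟩
  rw [h1, norm_smul, norm_inv, Real.norm_eq_abs, abs_of_pos hs]
  rw [add_sub_cancel_left, abs_of_pos hs] at h2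
  rw [inv_mul_le_iff₀ hs]
  linarith

theorem norm_forwardAverage_le [CompleteSpace E] {φ : ℝ → E} (hφ : Continuous φ)
    {s C : ℝ} (hs : 0 < s) (h : ∀ u, ‖φ u‖ ≤ C) (x : ℝ) : ‖forwardAverage φ s x‖ ≤ C := by
  simpa using norm_forwardAverage_sub_le hφ hs (x := x) (c := 0) (C := C)
    (fun u _ => by simpa using h u)

theorem hasDerivAt_forwardAverage [CompleteSpace E] {φ : ℝ → E} (hφ : Continuous φ) (s x : ℝ) :
    HasDerivAt (forwardAverage φ s) (s⁻¹ • (φ (x + s) - φ x)) x := by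
  have hF : ∀ y, HasDerivAt (fun y => ∫ u in (0 : ℝ)..y, φ u) (φ y) y := fun y =>
    intervalIntegral.integral_hasDerivAt_right (hφ.intervalIntegrable _ _)
      (hφ.stronglyMeasurableAtFilter _ _) hφ.continuousAt
  have h := (((hF (x + s)).comp_add_const x s).sub (hF x)).const_smul s⁻¹
  refine h.congr_of_eventuallyEq (Eventually.of_forall fun y => ?_)
  simp [forwardAverage, intervalIntegral.integral_interval_sub_left
    (hφ.intervalIntegrable _ _) (hφ.intervalIntegrable _ _)]

theorem continuous_forwardAverage [CompleteSpace E] {φ : ℝ → E} (hφ : Continuous φ) (s : ℝ) :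
    Continuous (forwardAverage φ s) :=
  continuous_iff_continuousAt.2 fun x => (hasDerivAt_forwardAverage hφ s x).continuousAt

/-- Fubini. The common double average serves to compare averages at two different scales. -/
theorem forwardAverage_forwardAverage_comm [CompleteSpace E] {φ : ℝ → E} (hφ : Continuous φ)
    (S T x : ℝ) :
    forwardAverage (forwardAverage φ S) T x = forwardAverage (forwardAverage φ T) S x := by
  have key : ∀ S T : ℝ, forwardAverage (forwardAverage φ S) T x =
      (T⁻¹ * S⁻¹) • ∫ u in x..x + T, ∫ v in (0 : ℝ)..S, φ (u + v) := by
    intro S T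
    simp only [forwardAverage, intervalIntegral.integral_smul, smul_smul]
    congr 2 with u
    simp [intervalIntegral.integral_comp_add_left]
  have hshift : ∀ S T : ℝ, ∫ u in x..x + T, ∫ v in (0 : ℝ)..S, φ (u + v) =
      ∫ u in (0 : ℝ)..T, ∫ v in (0 : ℝ)..S, φ (x + u + v) := by
    intro S T
    have := intervalIntegral.integral_comp_add_left (a := 0) (b := T)
      (fun u => ∫ v in (0 : ℝ)..S, φ (u + v)) x
    simpa using this.symm
  rw [key, key, hshift, hshift, mul_comm]
  congr 1
  rw [intervalIntegral_intervalIntegral_swap]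
  · simp only [add_right_comm]
  · have hc : Continuous (Function.uncurry fun u v => φ (x + u + v)) := by fun_prop
    exact (hc.continuousOn.integrableOn_compact
      (isCompact_uIcc.prod isCompact_uIcc)).mono_set
        (Set.prod_mono Set.uIoc_subset_uIcc Set.uIoc_subset_uIcc)

end ForwardAverage

/-! ### Almost periodic functions and their mean -/

theorem mem_almostPeriods_norm_sub_lt {f : ℝ → ℂ} {ε t : ℝ} (h : t ∈ almostPeriods f ε) (x : ℝ) :
    ‖f x - f (x - t)‖ < ε := by
  have h1 : ‖f x - f (x - t)‖ₑ < ENNReal.ofReal ε :=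
    lt_of_le_of_lt (le_iSup (fun x => ‖f x - f (x - t)‖ₑ) x) h
  rw [← ofReal_norm] at h1
  exact (ENNReal.ofReal_lt_ofReal_iff_of_nonneg (norm_nonneg _)).1 h1

namespace IsBohrAlmostPeriodic

variable {f : ℝ → ℂ}

/-- Every point can be moved into a fixed compact interval by subtracting an almost period. -/
theorem exists_almostPeriod (hf : IsBohrAlmostPeriodic f) {ε : ℝ} (hε : 0 < ε) :
    ∃ L : ℝ, 0 < L ∧ ∀ a : ℝ, ∃ t : ℝ, a - t ∈ Set.Icc 0 L ∧ ∀ x, ‖f x - f (x - t)‖ < ε := by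
  obtain ⟨L, hL, h⟩ := hf.2 ε hε
  refine ⟨L, hL, fun a => ?_⟩
  obtain ⟨t, ht, h1, h2⟩ := h (a - L)
  exact ⟨t, ⟨by linarith, by linarith⟩, mem_almostPeriods_norm_sub_lt ht⟩

theorem exists_norm_le (hf : IsBohrAlmostPeriodic f) : ∃ B : ℝ, ∀ x, ‖f x‖ ≤ B := by
  obtain ⟨L, -, h⟩ := hf.exists_almostPeriod one_pos
  obtain ⟨C, hC⟩ := (isCompact_Icc (a := (0 : ℝ)) (b := L)).exists_bound_of_continuousOn
    hf.1.continuousOn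
  refine ⟨1 + C, fun x => ?_⟩
  obtain ⟨t, ht, h1⟩ := h x
  have := norm_le_norm_sub_add (f x) (f (x - t))
  linarith [h1 x, hC _ ht]

theorem uniformContinuous (hf : IsBohrAlmostPeriodic f) : UniformContinuous f := by
  rw [Metric.uniformContinuous_iff]
  intro ε hε
  obtain ⟨L, -, h⟩ := hf.exists_almostPeriod (ε := ε / 3) (by linarith)
  -- The compact interval is enlarged by 1 on each side so that it also contains `y - t`.
  have huc := (isCompact_Icc (a := (-1 : ℝ)) (b := L + 1)).uniformContinuousOn_of_continuous
    hf.1.continuousOn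
  rw [Metric.uniformContinuousOn_iff] at huc
  obtain ⟨δ, hδ, hd⟩ := huc (ε / 3) (by linarith)
  refine ⟨min δ 1, lt_min hδ one_pos, fun x y hxy => ?_⟩
  obtain ⟨t, ⟨ht1, ht2⟩, h1⟩ := h x
  have hxy1 : |x - y| < 1 := lt_of_lt_of_le hxy (min_le_right _ _)
  rw [abs_lt] at hxy1
  have h2 := hd (x - t) ⟨by linarith, by linarith⟩ (y - t) ⟨by linarith, by linarith⟩
    (by simpa using lt_of_lt_of_le hxy (min_le_left _ _))
  have h3 := h1 x
  have h4 := h1 y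
  rw [← dist_eq_norm] at h3 h4
  have h5 := dist_triangle4 (f x) (f (x - t)) (f (y - t)) (f y)
  rw [dist_comm (f (y - t))] at h5
  linarith

/-- Averages over long intervals depend little on the position of the interval. -/
theorem exists_norm_forwardAverage_sub_le (hf : IsBohrAlmostPeriodic f) {ε : ℝ} (hε : 0 < ε) :
    ∃ T₀ : ℝ, 0 < T₀ ∧ ∀ T ≥ T₀, ∀ a,
      ‖forwardAverage f T a - forwardAverage f T 0‖ ≤ ε := by
  obtain ⟨B, hB⟩ := hf.exists_norm_le
  obtain ⟨L, hL, h⟩ := hf.exists_almostPeriod (ε := ε / 2) (by linarith)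
  have hB0 : 0 ≤ B := (norm_nonneg _).trans (hB 0)
  have hfi : ∀ a b, IntervalIntegrable f volume a b := fun a b => hf.1.intervalIntegrable a b
  have hbound : ∀ a b, ‖∫ x in a..b, f x‖ ≤ B * |b - a| := fun a b =>
    intervalIntegral.norm_integral_le_of_norm_le_const fun x _ => hB x
  -- Translating by `t` costs `ε / 2 * T`; the two end pieces, of length at most `L`, cost `2 * B *
  -- L`, which is at most `ε / 2 * T` for these `T`.
  refine ⟨4 * L * B / ε + 1, by positivity, fun T hT a => ?_⟩
  have hT0 : 0 < T := lt_of_lt_of_le (by positivity) hT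
  obtain ⟨t, ⟨ht1, ht2⟩, h1⟩ := h a
  have e1 : ‖(∫ x in a..a + T, f x) - ∫ x in a - t..a - t + T, f x‖ ≤ ε / 2 * T := by
    have : ∫ x in a - t..a - t + T, f x = ∫ x in a..a + T, f (x - t) := by
      rw [intervalIntegral.integral_comp_sub_right]
      congr 1; ring
    have hshift_int : IntervalIntegrable (fun x => f (x - t)) volume a (a + T) :=
      (hf.1.comp (continuous_sub_right t)).intervalIntegrable _ _
    rw [this, ← intervalIntegral.integral_sub (hfi _ _) hshift_int]
    have := intervalIntegral.norm_integral_le_of_norm_le_const (a := a) (b := a + T)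
      (f := fun x => f x - f (x - t)) (C := ε / 2) fun x _ => (h1 x).le
    rwa [add_sub_cancel_left, abs_of_pos hT0] at this
  have e2 : (∫ x in a - t..a - t + T, f x) - ∫ x in (0 : ℝ)..0 + T, f x =
      (∫ x in T..a - t + T, f x) - ∫ x in (0 : ℝ)..a - t, f x := by
    have h2 := intervalIntegral.integral_add_adjacent_intervals (hfi 0 (a - t))
      (hfi (a - t) (a - t + T))
    have h3 := intervalIntegral.integral_add_adjacent_intervals (hfi 0 T) (hfi T (a - t + T))
    rw [zero_add]
    linear_combination h2 - h3
  have e3 : ‖(∫ x in T..a - t + T, f x) - ∫ x in (0 : ℝ)..a - t, f x‖ ≤ B * L + B * L := by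
    refine (norm_sub_le _ _).trans (add_le_add ((hbound _ _).trans ?_) ((hbound _ _).trans ?_))
    · rw [add_sub_cancel_right, abs_of_nonneg ht1]; gcongr
    · rw [sub_zero, abs_of_nonneg ht1]; gcongr
  have e4 : ‖(∫ x in a..a + T, f x) - ∫ x in (0 : ℝ)..0 + T, f x‖ ≤
      ε / 2 * T + (B * L + B * L) := by
    rw [← sub_add_sub_cancel _ (∫ x in a - t..a - t + T, f x), e2]
    exact (norm_add_le _ _).trans (add_le_add e1 e3)
  have e5 : 4 * L * B ≤ ε * T := by
    have : 4 * L * B / ε ≤ T := by linarith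
    rwa [div_le_iff₀' hε] at this
  rw [forwardAverage, forwardAverage, ← smul_sub, norm_smul, norm_inv, Real.norm_eq_abs,
    abs_of_pos hT0, inv_mul_le_iff₀ hT0]
  linarith

/-- Averages of a Bohr almost periodic function over long intervals converge uniformly. -/
theorem exists_forwardAverage_mean (hf : IsBohrAlmostPeriodic f) :
    ∃ M : ℂ, ∀ ε > 0, ∃ T₀ : ℝ, 0 < T₀ ∧ ∀ T ≥ T₀, ∀ a, ‖forwardAverage f T a - M‖ ≤ ε := by
  have hcauchy : ∀ ε > 0, ∃ T₀ : ℝ, 0 < T₀ ∧ ∀ S ≥ T₀, ∀ T ≥ T₀,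
      ‖forwardAverage f S 0 - forwardAverage f T 0‖ ≤ ε := by
    intro ε hε
    obtain ⟨T₀, hT₀, h⟩ := hf.exists_norm_forwardAverage_sub_le (ε := ε / 2) (by linarith)
    refine ⟨T₀, hT₀, fun S hS T hT => ?_⟩
    -- Averaging a nearly constant function barely moves it, so the double average at scales `S`,
    -- `T` is within `ε / 2` of each single average at 0.
    have h1 := norm_forwardAverage_sub_le (continuous_forwardAverage hf.1 S)
      (hT₀.trans_le hT) (x := 0) (fun u _ => h S hS u)
    have h2 := norm_forwardAverage_sub_le (continuous_forwardAverage hf.1 T)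
      (hT₀.trans_le hS) (x := 0) (fun u _ => h T hT u)
    rw [forwardAverage_forwardAverage_comm hf.1] at h1
    rw [norm_sub_rev] at h1
    have := norm_sub_le_norm_sub_add_norm_sub (forwardAverage f S 0)
      (forwardAverage (forwardAverage f T) S 0) (forwardAverage f T 0)
    linarith
  have hc : CauchySeq fun T => forwardAverage f T 0 := by
    rw [Metric.cauchySeq_iff]
    intro ε hε
    obtain ⟨T₀, -, h⟩ := hcauchy (ε / 2) (by linarith)
    refine ⟨T₀, fun S hS T hT => ?_⟩
    rw [dist_eq_norm]
    linarith [h S hS T hT]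
  obtain ⟨M, hM⟩ := cauchySeq_tendsto_of_complete hc
  refine ⟨M, fun ε hε => ?_⟩
  obtain ⟨T₁, hT₁, h1⟩ := hf.exists_norm_forwardAverage_sub_le (ε := ε / 2) (by linarith)
  obtain ⟨T₂, h2⟩ := (Metric.tendsto_atTop.1 hM) (ε / 2) (by linarith)
  refine ⟨max T₁ T₂, lt_max_of_lt_left hT₁, fun T hT a => ?_⟩
  have h3 := h1 T ((le_max_left _ _).trans hT) a
  have h4 := h2 T ((le_max_right _ _).trans hT)
  rw [dist_eq_norm] at h4
  have := norm_sub_le_norm_sub_add_norm_sub (forwardAverage f T a) (forwardAverage f T 0) M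
  linarith

end IsBohrAlmostPeriodic

theorem hasMean_of_forwardAverage {f : ℝ → ℂ} {M : ℂ}
    (h : ∀ ε > 0, ∃ T₀ : ℝ, 0 < T₀ ∧ ∀ T ≥ T₀, ∀ a, ‖forwardAverage f T a - M‖ ≤ ε) :
    HasMean f M := by
  rw [HasMean, Metric.tendstoUniformly_iff]
  intro ε hε
  obtain ⟨T₀, hT₀, h⟩ := h (ε / 2) (by linarith)
  filter_upwards [eventually_ge_atTop T₀] with T hT a
  have h1 := h (2 * T) (by linarith) (a - T)
  rw [forwardAverage, show a - T + 2 * T = a + T by ring, ← one_div] at h1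
  rw [dist_comm, dist_eq_norm]
  linarith

/-! ### From mean-square bounds to almost everywhere convergence -/

/-- Square-root cancellation in mean square gives almost everywhere convergence of the averages of a
uniformly bounded sequence of functions. -/
theorem ae_tendsto_average_zero_of_integral_sq_le {Ω : Type*} [MeasurableSpace Ω] {μ : Measure Ω}
    [IsFiniteMeasure μ] {X : ℕ → Ω → ℝ} (hX : ∀ n, Measurable (X n)) {B C : ℝ}
    (hB : ∀ n ω, |X n ω| ≤ B)
    (hC : ∀ N : ℕ, ∫ ω, (∑ n ∈ Finset.range N, X n ω) ^ 2 ∂μ ≤ C * N) :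
    ∀ᵐ ω ∂μ, Tendsto (fun N : ℕ => (N : ℝ)⁻¹ * ∑ n ∈ Finset.range N, X n ω) atTop (𝓝 0) := by
  set S : ℕ → Ω → ℝ := fun N ω => ∑ n ∈ Finset.range N, X n ω with hS
  have hSm : ∀ N, Measurable (S N) := fun N => Finset.measurable_sum _ fun n _ => hX n
  have hSB : ∀ M N, M ≤ N → ∀ ω, |S N ω - S M ω| ≤ (N - M : ℝ) * B := by
    intro M N hMN ω
    simp only [hS]
    rw [← Finset.sum_Ico_eq_sub _ hMN]
    refine (Finset.abs_sum_le_sum_abs _ _).trans ?_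
    refine (Finset.sum_le_card_nsmul _ _ B fun n _ => hB n ω).trans ?_
    rw [Nat.card_Ico, nsmul_eq_mul, Nat.cast_sub hMN]
  have hfi : ∀ N, Integrable (fun ω => S N ω ^ 2) μ := by
    intro N
    refine Integrable.of_bound ((hSm N).pow_const 2).aestronglyMeasurable ((N * B) ^ 2)
      (Eventually.of_forall fun ω => ?_)
    have := hSB 0 N (Nat.zero_le _) ω
    simp only [hS, Finset.range_zero, Finset.sum_empty, sub_zero, Nat.cast_zero] at this
    rw [norm_pow, Real.norm_eq_abs]
    exact pow_le_pow_left₀ (abs_nonneg _) this 2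
  -- Along squares the integrals are at most `C / k ^ 2`, so the sum of the `Y k` is finite almost
  -- everywhere.
  let Y : ℕ → Ω → ℝ := fun k ω => (S (k ^ 2) ω / (k : ℝ) ^ 2) ^ 2
  have hYint : ∀ k, ∫⁻ ω, ENNReal.ofReal (Y k ω) ∂μ ≤ ENNReal.ofReal (C * (1 / (k : ℝ) ^ 2)) := by
    intro k
    have hYi : Integrable (Y k) μ := by
      simpa [Y, div_pow] using (hfi (k ^ 2)).div_const (((k : ℝ) ^ 2) ^ 2)
    rw [← ofReal_integral_eq_lintegral_ofReal hYi (Eventually.of_forall fun ω => sq_nonneg _)]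
    apply ENNReal.ofReal_le_ofReal
    simp only [Y, div_pow]
    rw [integral_div]
    rcases Nat.eq_zero_or_pos k with rfl | hk
    · simp
    have hk' : (0 : ℝ) < k := by exact_mod_cast hk
    rw [div_le_iff₀ (by positivity)]
    refine (hC (k ^ 2)).trans (le_of_eq ?_)
    push_cast
    field_simp
  have hsum : ∑' k, ∫⁻ ω, ENNReal.ofReal (Y k ω) ∂μ ≠ ⊤ := by
    have hs : Summable fun k : ℕ => C * (1 / (k : ℝ) ^ 2) :=
      (Real.summable_one_div_nat_pow.2 one_lt_two).mul_left C
    exact ne_top_of_le_ne_top hs.tsum_ofReal_ne_top (ENNReal.tsum_le_tsum hYint)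
  have hYm : ∀ k, Measurable fun ω => ENNReal.ofReal (Y k ω) := fun k =>
    (((hSm _).div_const _).pow_const 2).ennreal_ofReal
  rw [← lintegral_tsum fun k => (hYm k).aemeasurable] at hsum
  filter_upwards [ae_lt_top (Measurable.tsum hYm) hsum] with ω hω
  have h1 : Tendsto (fun k => Y k ω) atTop (𝓝 0) := by
    have := (ENNReal.tendsto_toReal ENNReal.zero_ne_top).comp
      (ENNReal.tendsto_atTop_zero_of_tsum_ne_top hω.ne)
    simpa [Function.comp_def, Y, ENNReal.toReal_ofReal, sq_nonneg] using this
  have h2 : Tendsto (fun k : ℕ => |S (k ^ 2) ω / (k : ℝ) ^ 2|) atTop (𝓝 0) := by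
    have := (Real.continuous_sqrt.tendsto 0).comp h1
    simpa [Function.comp_def, Y, Real.sqrt_sq_eq_abs] using this
  have h3 : Tendsto (fun k : ℕ => |S (k ^ 2) ω / (k : ℝ) ^ 2| + 2 * B / k) atTop (𝓝 0) := by
    simpa using h2.add (tendsto_const_div_atTop_nhds_zero_nat (2 * B))
  have hsqrt : Tendsto Nat.sqrt atTop atTop :=
    tendsto_atTop_atTop.2 fun b => ⟨b ^ 2, fun a ha => Nat.le_sqrt'.2 ha⟩
  -- With k = ⌊√N⌋, at most 2k terms lie between k² and N; after division by k² they contribute at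
  -- most `2 * B / k`.
  refine squeeze_zero_norm' ?_ (h3.comp hsqrt)
  filter_upwards [eventually_ge_atTop 1] with N hN
  set k := Nat.sqrt N with hk
  have hk1 : 1 ≤ k := Nat.le_sqrt'.2 (by simpa using hN)
  have hkN : k ^ 2 ≤ N := Nat.sqrt_le' N
  have hNk : N ≤ k ^ 2 + 2 * k := by
    have := Nat.lt_succ_sqrt' N
    rw [← hk] at this
    simp only [Nat.succ_eq_add_one] at this
    nlinarith
  have hk0 : (0 : ℝ) < k := by exact_mod_cast hk1
  have hB0 : 0 ≤ B := (abs_nonneg _).trans (hB 0 ω)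
  have hkN' : (k : ℝ) ^ 2 ≤ N := by exact_mod_cast hkN
  have hNk' : (N : ℝ) ≤ (k : ℝ) ^ 2 + 2 * k := by exact_mod_cast hNk
  have hd := hSB _ _ hkN ω
  push_cast at hd
  have hSN : |S N ω| ≤ |S (k ^ 2) ω| + 2 * k * B := by
    have h4 : |S N ω| ≤ |S N ω - S (k ^ 2) ω| + |S (k ^ 2) ω| := by
      have := abs_add_le (S N ω - S (k ^ 2) ω) (S (k ^ 2) ω)
      rwa [sub_add_cancel] at this
    have h5 : ((N : ℝ) - (k : ℝ) ^ 2) * B ≤ 2 * k * B := by gcongr; linarith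
    linarith
  rw [Real.norm_eq_abs, abs_mul, abs_inv, Nat.abs_cast]
  have : (N : ℝ)⁻¹ * |S N ω| ≤ ((k : ℝ) ^ 2)⁻¹ * (|S (k ^ 2) ω| + 2 * k * B) := by gcongr
  refine this.trans (le_of_eq ?_)
  simp only [Function.comp_apply, ← hk]
  rw [abs_div, abs_of_pos (by positivity : (0 : ℝ) < (k : ℝ) ^ 2)]
  field_simp

/-! ### Decay of correlations -/

/-- If `g` has a bounded primitive `G` and a bounded derivative, then `g (p x)` and `g (q x)` are
nearly orthogonal on bounded intervals when `|p|` is much larger than `|q|`. -/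
theorem abs_integral_mul_comp_mul_le {G g g' : ℝ → ℝ} (hG : ∀ x, HasDerivAt G (g x) x)
    (hg : ∀ x, HasDerivAt g (g' x) x) (hg' : Continuous g') {B : ℝ} (hGB : ∀ x, |G x| ≤ B)
    (hgB : ∀ x, |g x| ≤ B) (hgB' : ∀ x, |g' x| ≤ B) {p q R : ℝ} (hp : p ≠ 0) (hq : 1 ≤ |q|)
    (hR : 0 ≤ R) :
    |∫ x in -R..R, g (p * x) * g (q * x)| ≤ (2 + 2 * R) * B ^ 2 * (|q| / |p|) := by
  have hB0 : 0 ≤ B := (abs_nonneg _).trans (hGB 0)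
  have hgc : Continuous g := continuous_iff_continuousAt.2 fun x => (hg x).continuousAt
  have hGc : Continuous G := continuous_iff_continuousAt.2 fun x => (hG x).continuousAt
  have hu : ∀ x, HasDerivAt (fun x => g (q * x)) (g' (q * x) * q) x := fun x =>
    (hg (q * x)).comp x (by simpa using (hasDerivAt_id x).const_mul q)
  have hv : ∀ x, HasDerivAt (fun x => G (p * x) / p) (g (p * x)) x := fun x => by
    have := ((hG (p * x)).comp x (by simpa using (hasDerivAt_id x).const_mul p)).div_const p
    rwa [mul_div_cancel_right₀ _ hp] at this
  -- Integrating the fast factor gains `1 / p`; differentiating the slow one costs only `q`.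
  have hparts := intervalIntegral.integral_mul_deriv_eq_deriv_mul (a := -R) (b := R)
    (fun x _ => hu x) (fun x _ => hv x)
    ((by fun_prop : Continuous fun x => g' (q * x) * q).intervalIntegrable _ _)
    ((by fun_prop : Continuous fun x => g (p * x)).intervalIntegrable _ _)
  have hb : ∀ x y, |g x * (G y / p)| ≤ B ^ 2 / |p| := fun x y => by
    rw [abs_mul, abs_div, ← mul_div_assoc, sq]
    gcongr
    exacts [hgB x, hGB y]
  have hi : |∫ x in -R..R, g' (q * x) * q * (G (p * x) / p)| ≤
      B ^ 2 * (|q| / |p|) * |R - -R| := by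
    rw [← Real.norm_eq_abs]
    refine intervalIntegral.norm_integral_le_of_norm_le_const fun x _ => ?_
    rw [Real.norm_eq_abs, abs_mul, abs_mul, abs_div]
    calc |g' (q * x)| * |q| * (|G (p * x)| / |p|) ≤ B * |q| * (B / |p|) := by
          gcongr
          exacts [hgB' _, hGB _]
      _ = B ^ 2 * (|q| / |p|) := by ring
  rw [show |R - -R| = 2 * R by rw [abs_of_nonneg] <;> linarith] at hi
  -- The boundary terms lack the factor |q|, so `1 ≤ |q|` is used to absorb them.
  have hbq : B ^ 2 / |p| ≤ B ^ 2 * (|q| / |p|) := by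
    rw [div_eq_mul_one_div]
    gcongr
  simp only [mul_comm (g (p * _))]
  rw [hparts]
  have h1 := hb (q * R) (p * R)
  have h2 := hb (q * -R) (p * -R)
  have h3 := abs_sub (g (q * R) * (G (p * R) / p) - g (q * -R) * (G (p * -R) / p))
    (∫ x in -R..R, g' (q * x) * q * (G (p * x) / p))
  have h4 := abs_sub (g (q * R) * (G (p * R) / p)) (g (q * -R) * (G (p * -R) / p))
  linarith

theorem sum_range_pow_sub_le {ρ : ℝ} (h0 : 0 ≤ ρ) (h1 : ρ < 1) (N : ℕ) :
    ∑ m ∈ Finset.range N, ρ ^ (N - m) ≤ (1 - ρ)⁻¹ := by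
  have h2 : ∑ m ∈ Finset.range N, ρ ^ (N - m) ≤ ∑ m ∈ Finset.range (N + 1), ρ ^ (N - m) :=
    Finset.sum_le_sum_of_subset_of_nonneg (Finset.range_mono (Nat.le_succ N))
      fun _ _ _ => pow_nonneg h0 _
  refine h2.trans ?_
  have h3 := Finset.sum_range_reflect (fun j => ρ ^ j) (N + 1)
  simp only [Nat.add_sub_cancel] at h3
  rw [h3, ← tsum_geometric_of_lt_one h0 h1]
  exact (summable_geometric_of_lt_one h0 h1).sum_le_tsum _ fun _ _ => pow_nonneg h0 _

/-- Exponentially decaying correlations give a linear bound for the mean square of partial sums. -/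
theorem integral_sq_sum_le_of_correlation {h : ℕ → ℝ → ℝ} (hc : ∀ n, Continuous (h n))
    {a b C ρ : ℝ} (hC : 0 ≤ C) (h0 : 0 ≤ ρ) (h1 : ρ < 1)
    (hcorr : ∀ m n, m ≤ n → |∫ x in a..b, h n x * h m x| ≤ C * ρ ^ (n - m)) (N : ℕ) :
    ∫ x in a..b, (∑ n ∈ Finset.range N, h n x) ^ 2 ≤ (C + 2 * C * (1 - ρ)⁻¹) * N := by
  induction N with
  | zero => simp
  | succ N ih =>
    -- The increment is one diagonal term and twice a row of cross terms, the latter bounded by a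
    -- geometric series independently of `N`.
    have hexp : ∀ x, (∑ n ∈ Finset.range (N + 1), h n x) ^ 2 =
        (∑ n ∈ Finset.range N, h n x) ^ 2 + (2 * ∑ m ∈ Finset.range N, h N x * h m x +
          h N x * h N x) := by
      intro x
      rw [Finset.sum_range_succ, ← Finset.mul_sum]
      ring
    have hdiag : ∫ x in a..b, h N x * h N x ≤ C := by
      simpa using (le_abs_self _).trans (hcorr N N le_rfl)
    have hoff : ∑ m ∈ Finset.range N, ∫ x in a..b, h N x * h m x ≤ C * (1 - ρ)⁻¹ := by
      calc ∑ m ∈ Finset.range N, ∫ x in a..b, h N x * h m x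
          ≤ ∑ m ∈ Finset.range N, C * ρ ^ (N - m) := Finset.sum_le_sum fun m hm =>
            (le_abs_self _).trans (hcorr m N (Finset.mem_range.1 hm).le)
        _ ≤ C * (1 - ρ)⁻¹ := by
            rw [← Finset.mul_sum]
            gcongr
            exact sum_range_pow_sub_le h0 h1 N
    have hprod : ∀ m n, IntervalIntegrable (fun x => h n x * h m x) volume a b := fun m n =>
      ((hc n).mul (hc m)).intervalIntegrable _ _
    have hsumc : Continuous fun x => ∑ m ∈ Finset.range N, h N x * h m x :=
      continuous_finsetSum _ fun m _ => (hc N).mul (hc m)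
    have hsq : IntervalIntegrable (fun x => (∑ n ∈ Finset.range N, h n x) ^ 2) volume a b :=
      (by fun_prop : Continuous _).intervalIntegrable _ _
    have hlin : IntervalIntegrable (fun x => 2 * ∑ m ∈ Finset.range N, h N x * h m x) volume a b :=
      (hsumc.const_mul 2).intervalIntegrable _ _
    simp only [hexp]
    rw [intervalIntegral.integral_add hsq (hlin.add (hprod N N)),
      intervalIntegral.integral_add hlin (hprod N N),
      intervalIntegral.integral_const_mul, intervalIntegral.integral_finsetSum fun m _ => hprod m N]
    push_cast
    linarith

theorem ae_tendsto_average_zero_of_bounded_primitive {α : ℝ} (hα : 1 < |α|) {G g g' : ℝ → ℝ}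
    (hG : ∀ x, HasDerivAt G (g x) x) (hg : ∀ x, HasDerivAt g (g' x) x) (hg' : Continuous g')
    {B : ℝ} (hGB : ∀ x, |G x| ≤ B) (hgB : ∀ x, |g x| ≤ B) (hgB' : ∀ x, |g' x| ≤ B) :
    ∀ᵐ x : ℝ, Tendsto (fun N : ℕ => (N : ℝ)⁻¹ * ∑ n ∈ Finset.range N, g (α ^ n * x))
      atTop (𝓝 0) := by
  have hα0 : 0 < |α| := by linarith
  have hgc : Continuous g := continuous_iff_continuousAt.2 fun x => (hg x).continuousAt
  have hR : ∀ R : ℕ, ∀ᵐ x ∂volume.restrict (Set.Ioc (-R : ℝ) R),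
      Tendsto (fun N : ℕ => (N : ℝ)⁻¹ * ∑ n ∈ Finset.range N, g (α ^ n * x)) atTop (𝓝 0) := by
    intro R
    have hc : ∀ n : ℕ, Continuous fun x => g (α ^ n * x) := fun n => by fun_prop
    refine ae_tendsto_average_zero_of_integral_sq_le (fun n => (hc n).measurable)
      (C := (2 + 2 * (R : ℝ)) * B ^ 2 + 2 * ((2 + 2 * (R : ℝ)) * B ^ 2) * (1 - |α|⁻¹)⁻¹)
      (fun n x => hgB _) (fun N => ?_)
    rw [← intervalIntegral.integral_of_le (by linarith [R.cast_nonneg (α := ℝ)])]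
    refine integral_sq_sum_le_of_correlation hc (by positivity) (by positivity)
      (inv_lt_one_of_one_lt₀ hα) (fun m n hmn => ?_) N
    have := abs_integral_mul_comp_mul_le hG hg hg' hGB hgB hgB' (p := α ^ n) (q := α ^ m)
      (pow_ne_zero n (abs_pos.1 hα0)) (by rw [abs_pow]; exact one_le_pow₀ hα.le)
      (R.cast_nonneg (α := ℝ))
    refine this.trans (le_of_eq ?_)
    rw [abs_pow, abs_pow, inv_pow, pow_sub₀ _ hα0.ne' hmn, mul_inv, inv_inv, div_eq_mul_inv,
      mul_comm (|α| ^ m)]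
  have hall : ∀ᵐ x : ℝ, ∀ R : ℕ, x ∈ Set.Ioc (-R : ℝ) R →
      Tendsto (fun N : ℕ => (N : ℝ)⁻¹ * ∑ n ∈ Finset.range N, g (α ^ n * x)) atTop (𝓝 0) :=
    ae_all_iff.2 fun R => (ae_restrict_iff' measurableSet_Ioc).1 (hR R)
  filter_upwards [hall] with x hx
  obtain ⟨R, hR⟩ := exists_nat_gt |x|
  exact hx R ⟨(abs_lt.1 hR).1, (abs_lt.1 hR).2.le⟩

/-! ### Approximation and conclusion -/

/-- A bounded uniformly continuous function with vanishing mean is uniformly close to a function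
with bounded derivative and bounded primitive. -/
theorem exists_approx_bounded_primitive {f : ℝ → ℝ} (hf : UniformContinuous f) {B : ℝ}
    (hB : ∀ x, |f x| ≤ B) {ε L : ℝ} (hε : 0 < ε) (hL : 0 < L)
    (hmean : ∀ a, |forwardAverage f L a| ≤ ε) :
    ∃ (G g g' : ℝ → ℝ) (C : ℝ), (∀ x, HasDerivAt G (g x) x) ∧ (∀ x, HasDerivAt g (g' x) x) ∧
      Continuous g' ∧ (∀ x, |G x| ≤ C) ∧ (∀ x, |g x| ≤ C) ∧ (∀ x, |g' x| ≤ C) ∧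
      ∀ x, |f x - g x| ≤ 3 * ε := by
  have hfc := hf.continuous
  obtain ⟨δ, hδ, hd⟩ := Metric.uniformContinuous_iff.1 hf ε hε
  set s := δ / 2 with hs_def
  have hs : 0 < s := by positivity
  set h := forwardAverage f s with hh_def
  have hh : ∀ x, HasDerivAt h (s⁻¹ • (f (x + s) - f x)) x := hasDerivAt_forwardAverage hfc s
  have hhc : Continuous h := continuous_forwardAverage hfc s
  have hhB : ∀ x, |h x| ≤ B := norm_forwardAverage_le hfc hs hB
  have hfh : ∀ x, |h x - f x| ≤ ε := fun x =>
    norm_forwardAverage_sub_le hfc hs fun u hu => by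
      refine (hd (a := u) (b := x) ?_).le
      rw [Real.dist_eq, abs_of_nonneg (by linarith [hu.1])]
      linarith [hu.2]
  set H : ℝ → ℝ := fun x => ∫ u in (0 : ℝ)..x, h u with hH_def
  have hH : ∀ x, HasDerivAt H (h x) x := fun x =>
    intervalIntegral.integral_hasDerivAt_right (hhc.intervalIntegrable _ _)
      (hhc.stronglyMeasurableAtFilter _ _) hhc.continuousAt
  have hHc : Continuous H := continuous_iff_continuousAt.2 fun x => (hH x).continuousAt
  have hHsub : ∀ x y, H y - H x = ∫ u in x..y, h u := fun x y =>
    intervalIntegral.integral_interval_sub_left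
      (hhc.intervalIntegrable _ _) (hhc.intervalIntegrable _ _)
  have hB0 : 0 ≤ B := (abs_nonneg _).trans (hB 0)
  have hG : ∀ x, |H x - forwardAverage H L x| ≤ B * L := fun x => by
    rw [abs_sub_comm]
    refine norm_forwardAverage_sub_le hHc hL fun u hu => ?_
    rw [hHsub]
    refine (intervalIntegral.norm_integral_le_of_norm_le_const (C := B) fun v _ => hhB v).trans ?_
    rw [abs_of_nonneg (by linarith [hu.1])]
    gcongr
    linarith [hu.2]
  have hAh : ∀ x, |forwardAverage h L x| ≤ B := norm_forwardAverage_le hhc hL hhB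
  have hquot : ∀ (k : ℝ → ℝ), (∀ x, |k x| ≤ B) → ∀ t > 0, ∀ x,
      |t⁻¹ • (k (x + t) - k x)| ≤ t⁻¹ * (B + B) := by
    intro k hk t ht x
    rw [smul_eq_mul, abs_mul, abs_of_pos (inv_pos.2 ht)]
    gcongr
    exact (abs_sub _ _).trans (add_le_add (hk _) (hk _))
  have hsB : 0 ≤ s⁻¹ * (B + B) := by positivity
  have hLB : 0 ≤ L⁻¹ * (B + B) := by positivity
  have hBL : 0 ≤ B * L := by positivity
  -- `H` itself may grow linearly, but it varies by at most `B * L` over length `L`, so subtracting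
  -- its average keeps it bounded. The derivative of that average is the average of `h`.
  refine ⟨fun x => H x - forwardAverage H L x, fun x => h x - forwardAverage h L x,
    fun x => s⁻¹ • (f (x + s) - f x) - L⁻¹ • (h (x + L) - h x),
    B * L + (B + B) + s⁻¹ * (B + B) + L⁻¹ * (B + B), fun x => ?_, fun x => ?_, by fun_prop,
    fun x => ?_, fun x => ?_, fun x => ?_, fun x => ?_⟩
  · have := (hH x).sub (hasDerivAt_forwardAverage hHc L x)
    rwa [hHsub] at this
  · exact (hh x).sub (hasDerivAt_forwardAverage hhc L x)
  · linarith [hG x]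
  · linarith [abs_sub (h x) (forwardAverage h L x), hhB x, hAh x]
  · linarith [abs_sub (s⁻¹ • (f (x + s) - f x)) (L⁻¹ • (h (x + L) - h x)), hquot f hB s hs x,
      hquot h hhB L hL x]
  -- The three errors, each at most `ε`: smoothing `f`, smoothing inside the long average, and the
  -- long average of `f`.
  · have hdiff : forwardAverage h L x - forwardAverage f L x =
        forwardAverage (fun u => h u - f u) L x := by
      simp only [forwardAverage]
      rw [intervalIntegral.integral_sub (hhc.intervalIntegrable _ _)
        (hfc.intervalIntegrable _ _), smul_sub]
    have h1 : |forwardAverage h L x - forwardAverage f L x| ≤ ε := by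
      rw [hdiff]
      exact norm_forwardAverage_le (hhc.sub hfc) hL hfh x
    have h2 := hmean x
    have h3 := hfh x
    rw [abs_le] at *
    constructor <;> linarith [h1.1, h1.2, h2.1, h2.2, h3.1, h3.2]

/-- Uniform limits preserve the conclusion; tolerances `1 / (j + 1)` keep the union of exceptional
null sets countable. -/
theorem ae_tendsto_average_zero_of_mean_zero {α : ℝ} (hα : 1 < |α|) {f : ℝ → ℝ}
    (hf : UniformContinuous f) {B : ℝ} (hB : ∀ x, |f x| ≤ B)
    (hmean : ∀ ε > 0, ∃ L > 0, ∀ a, |forwardAverage f L a| ≤ ε) :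
    ∀ᵐ x : ℝ, Tendsto (fun N : ℕ => (N : ℝ)⁻¹ * ∑ n ∈ Finset.range N, f (α ^ n * x))
      atTop (𝓝 0) := by
  have key : ∀ j : ℕ, ∀ᵐ x : ℝ, ∃ g : ℝ → ℝ, (∀ y, |f y - g y| ≤ 3 * (1 / ((j : ℝ) + 1))) ∧
      Tendsto (fun N : ℕ => (N : ℝ)⁻¹ * ∑ n ∈ Finset.range N, g (α ^ n * x)) atTop (𝓝 0) := by
    intro j
    have hj : (0 : ℝ) < 1 / ((j : ℝ) + 1) := by positivity
    obtain ⟨L, hL, hm⟩ := hmean _ hj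
    obtain ⟨G, g, g', C, hG, hg, hg', hGC, hgC, hgC', hfg⟩ :=
      exists_approx_bounded_primitive hf hB hj hL hm
    filter_upwards [ae_tendsto_average_zero_of_bounded_primitive hα hG hg hg' hGC hgC hgC']
      with x hx
    exact ⟨g, hfg, hx⟩
  filter_upwards [ae_all_iff.2 key] with x hx
  rw [Metric.tendsto_atTop]
  intro ε hε
  obtain ⟨j, hj⟩ := exists_nat_one_div_lt (show 0 < ε / 6 by positivity)
  obtain ⟨g, hfg, hlim⟩ := hx j
  obtain ⟨N₀, hN₀⟩ := Metric.tendsto_atTop.1 hlim (ε / 2) (by positivity)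
  refine ⟨N₀, fun N hN => ?_⟩
  have h1 := hN₀ N hN
  rw [Real.dist_eq, sub_zero] at h1 ⊢
  have h2 : |(N : ℝ)⁻¹ * ∑ n ∈ Finset.range N, f (α ^ n * x) -
      (N : ℝ)⁻¹ * ∑ n ∈ Finset.range N, g (α ^ n * x)| ≤ ε / 2 := by
    rw [← mul_sub, ← Finset.sum_sub_distrib, abs_mul, abs_inv, Nat.abs_cast]
    rcases Nat.eq_zero_or_pos N with rfl | hN0
    · simp; positivity
    rw [inv_mul_le_iff₀ (by exact_mod_cast hN0)]
    refine (Finset.abs_sum_le_sum_abs _ _).trans ?_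
    refine (Finset.sum_le_card_nsmul _ _ (ε / 2) fun n _ => (hfg _).trans (by linarith)).trans ?_
    simp
  have h3 := abs_add_le ((N : ℝ)⁻¹ * ∑ n ∈ Finset.range N, f (α ^ n * x) -
      (N : ℝ)⁻¹ * ∑ n ∈ Finset.range N, g (α ^ n * x))
      ((N : ℝ)⁻¹ * ∑ n ∈ Finset.range N, g (α ^ n * x))
  rw [sub_add_cancel] at h3
  linarith

/-- Averages of a bounded uniformly continuous function along `α ^ n * x` converge to its mean for
almost every `x`, when tested against a norm-nonincreasing real functional. -/
theorem ae_tendsto_average_of_mean {α : ℝ} (hα : 1 < |α|) {f : ℝ → ℂ}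
    (hf : UniformContinuous f) {B : ℝ} (hB : ∀ x, ‖f x‖ ≤ B) {M : ℂ}
    (hmean : ∀ ε > 0, ∃ L > 0, ∀ a, ‖forwardAverage f L a - M‖ ≤ ε)
    (ℓ : ℂ →L[ℝ] ℝ) (hℓ : ∀ z, |ℓ z| ≤ ‖z‖) :
    ∀ᵐ x : ℝ, Tendsto (fun N : ℕ => ℓ ((N : ℝ)⁻¹ • ∑ n ∈ Finset.range N, f (α ^ n * x)))
      atTop (𝓝 (ℓ M)) := by
  have hfc := hf.continuous
  have h := ae_tendsto_average_zero_of_mean_zero hα (f := fun x => ℓ (f x - M))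
    (ℓ.uniformContinuous.comp (hf.sub uniformContinuous_const)) (B := B + ‖M‖)
    (fun x => (hℓ _).trans ((norm_sub_le _ _).trans (by gcongr; exact hB x))) ?_
  · filter_upwards [h] with x hx
    have hx' := hx.add_const (ℓ M)
    rw [zero_add] at hx'
    refine hx'.congr' ?_
    filter_upwards [eventually_gt_atTop 0] with N hN
    have hN' : (N : ℝ) ≠ 0 := by exact_mod_cast hN.ne'
    simp only [map_sub, Finset.sum_sub_distrib, map_smul, map_sum, smul_eq_mul,
      Finset.sum_const, Finset.card_range, nsmul_eq_mul]
    rw [mul_sub, inv_mul_cancel_left₀ hN', sub_add_cancel]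
  · intro ε hε
    obtain ⟨L, hL, hm⟩ := hmean ε hε
    refine ⟨L, hL, fun a => ?_⟩
    have : forwardAverage (fun x => ℓ (f x - M)) L a = ℓ (forwardAverage f L a - M) := by
      simp only [forwardAverage]
      have hi : IntervalIntegrable (fun u => f u - M) volume a (a + L) :=
        (hfc.sub continuous_const).intervalIntegrable _ _
      rw [ℓ.intervalIntegral_comp_comm hi,
        ← map_smul, intervalIntegral.integral_sub (hfc.intervalIntegrable _ _) (by simp)]
      simp [smul_sub, hL.ne']
    rw [this]
    exact (hℓ _).trans (hm a)

theorem mainTheorem1 (α : ℝ) (hα : 1 < |α|) (f : ℝ → ℂ) (hf : IsBohrAlmostPeriodic f) :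
    ∃ M : ℂ, HasMean f M ∧
      ∀ᵐ x : ℝ, Tendsto (fun N : ℕ => (1 / (N : ℂ)) * ∑ n ∈ Finset.range N, f (α ^ n * x))
        atTop (𝓝 M) := by
  obtain ⟨M, hM⟩ := hf.exists_forwardAverage_mean
  obtain ⟨B, hB⟩ := hf.exists_norm_le
  refine ⟨M, hasMean_of_forwardAverage hM, ?_⟩
  have hM' : ∀ ε > 0, ∃ L > 0, ∀ a, ‖forwardAverage f L a - M‖ ≤ ε := fun ε hε => by
    obtain ⟨T, hT, h⟩ := hM ε hε
    exact ⟨T, hT, h T le_rfl⟩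
  filter_upwards [ae_tendsto_average_of_mean hα hf.uniformContinuous hB hM' Complex.reCLM
      Complex.abs_re_le_norm,
    ae_tendsto_average_of_mean hα hf.uniformContinuous hB hM' Complex.imCLM
      Complex.abs_im_le_norm] with x hre him
  have h := (Complex.continuous_ofReal.tendsto _).comp hre |>.add
    (((Complex.continuous_ofReal.tendsto _).comp him).mul_const Complex.I)
  simp only [Function.comp_def, Complex.reCLM_apply, Complex.imCLM_apply, Complex.re_add_im] at h
  simpa [Complex.real_smul] using h
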